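/- Let $\Phi\subset\mathbb{R}^n$ be an irreducible, reduced, crystallographic root system spanning the Euclidean space $\mathbb{R}^n$ (the root system of a compact simple Lie group of rank $n$), with simple roots $\Delta=\{\alpha_1,\dots,\alpha_n\}$ and highest root $\xi$. Put $\alpha_i^\vee=2\alpha_i/\langle\alpha_i,\alpha_i\rangle$ and $Q^\vee=\mathbb{Z}\alpha_1^\vee+\dots+\mathbb{Z}\alpha_n^\vee$. Let $W$ be the Weyl group, generated by the reflections $r_i a=a-\langle a,\alpha_i^\vee\rangle\alpha_i$, let $W^e=\{w\in W:\det w=1\}$, and let $W^{\mathrm{aff}}=Q^\vee\rtimes W$ and $W^{\mathrm{aff}}_e=Q^\vee\rtimes W^e$ act on $\mathbb{R}^n$ by $a\mapsto wa+q^\vee$. Let $$F=\{a\in\mathbb{R}^n:\ \langle a,\alpha\rangle\ge 0\ \text{for all }\alpha\in\Delta,\ \langle a,\xi\rangle\le 1\},$$ fix $j\in\{1,\dots,n\}$, and let $F^e=F\cup r_j\,\mathrm{int}(F)$, where $\mathrm{int}(F)$ is the interior of $F$. Then: 1. For every $a\in\mathbb{R}^n$ there exist $a'\in F^e$, $w\in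 W^e$ and $q^\vee\in Q^\vee$ such that $a=wa'+q^\vee$. 2. If $a,a'\in F^e$ and $a'=w^{\mathrm{aff}}a$ with $w^{\mathrm{aff}}\in W^{\mathrm{aff}}_e$, then $a=a'$; that is, if $a'=wa+q^\vee$ with $w\in W^e$ and $q^\vee\in Q^\vee$, then $a'=a=wa+q^\vee$. 3. If $a\in\mathrm{int}(F)$ or $a\in r_j\,\mathrm{int}(F)$, then the stabilizer $\mathrm{Stab}_{W^{\mathrm{aff}}_e}(a)$ is trivial. If $a\in F\setminus\mathrm{int}(F)$, then $\mathrm{Stab}_{W^{\mathrm{aff}}}(a)$ is finite and $|\mathrm{Stab}_{W^{\mathrm{aff}}}(a)|=2\,|\mathrm{Stab}_{W^{\mathrm{aff}}_e}(a)|$. -/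

import Mathlib

open scoped InnerProductSpace

noncomputable section

namespace EvenAffineWeyl

/-- A root pairing of `ℝⁿ` with itself is *Euclidean* if the pairing is the standard scalar product
and every coroot is `α^∨ = 2 α / ⟨α, α⟩`. Then `P.reflection i` is the orthogonal reflection
`a ↦ a - (2⟨a, α_i⟩ / ⟨α_i, α_i⟩) α_i`, and roots and coroots all live in the same space `ℝⁿ`. -/
structure IsEuclidean {n : ℕ} {ι : Type*}
    (P : RootPairing ι ℝ (EuclideanSpace ℝ (Fin n)) (EuclideanSpace ℝ (Fin n))) : Prop where
  pairing_eq : ∀ x y, P.toLinearMap x y = ⟪x, y⟫_ℝ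
  coroot_eq : ∀ i, P.coroot i = (2 / ⟪P.root i, P.root i⟫_ℝ) • P.root i

section

variable {n : ℕ} {ι : Type*}
  {P : RootPairing ι ℝ (EuclideanSpace ℝ (Fin n)) (EuclideanSpace ℝ (Fin n))}

/-- `ξ` is the highest root: every other root is obtained from it by subtracting a combination of
simple roots with nonnegative integer coefficients. -/
def IsHighestRoot (b : P.Base) (ξ : ι) : Prop :=
  ∀ i, P.root ξ - P.root i ∈ AddSubmonoid.closure (P.root '' b.support)

/-- The dual root lattice `Q^∨ = ℤ α₁^∨ + ⋯ + ℤ αₙ^∨`. -/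
def dualRootLattice (b : P.Base) : AddSubgroup (EuclideanSpace ℝ (Fin n)) :=
  AddSubgroup.closure (P.coroot '' b.support)

/-- The Weyl group `W`, generated by the simple reflections. -/
def weylGroup (b : P.Base) :
    Subgroup (EuclideanSpace ℝ (Fin n) ≃ₗ[ℝ] EuclideanSpace ℝ (Fin n)) :=
  Subgroup.closure (P.reflection '' b.support)

/-- The even Weyl group `W^e = {w ∈ W | det w = 1}`. -/
def evenWeylGroup (b : P.Base) :
    Subgroup (EuclideanSpace ℝ (Fin n) ≃ₗ[ℝ] EuclideanSpace ℝ (Fin n)) :=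
  weylGroup b ⊓ LinearEquiv.det.ker

theorem evenWeylGroup_le (b : P.Base) : evenWeylGroup b ≤ weylGroup b := inf_le_left

theorem reflection_mem_dualRootLattice [P.IsCrystallographic] (hP : IsEuclidean P) (b : P.Base)
    {i : ι} (hi : i ∈ b.support) {q : EuclideanSpace ℝ (Fin n)} (hq : q ∈ dualRootLattice b) :
    P.reflection i q ∈ dualRootLattice b := by
  induction hq using AddSubgroup.closure_induction with
  | zero => rw [map_zero]; exact zero_mem _
  | add x y _ _ hx hy => rw [map_add]; exact add_mem hx hy
  | neg x _ hx => rw [map_neg]; exact neg_mem hx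
  | mem x hx =>
    obtain ⟨k, hk, rfl⟩ := hx
    obtain ⟨z, hz⟩ := P.exists_value (S := ℤ) i k
    have h : P.reflection i (P.coroot k) = P.coroot k - z • P.coroot i := by
      rw [P.reflection_apply, ← Int.cast_smul_eq_zsmul ℝ z, ← eq_intCast (algebraMap ℤ ℝ) z, hz]
      congr 1
      have h1 : P.coroot' i (P.coroot k) = ⟪P.coroot k, P.coroot i⟫_ℝ := hP.pairing_eq _ _
      have h2 : P.pairing i k = ⟪P.root i, P.coroot k⟫_ℝ := hP.pairing_eq _ _
      rw [h1, h2, hP.coroot_eq i, inner_smul_right, smul_smul, mul_comm,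
        real_inner_comm]
    rw [h]
    have hmem : ∀ l ∈ b.support, P.coroot l ∈ dualRootLattice b := fun l hl =>
      AddSubgroup.subset_closure ⟨l, hl, rfl⟩
    exact sub_mem (hmem k hk) (zsmul_mem (hmem i hi) z)

theorem weylGroup_mem_dualRootLattice [P.IsCrystallographic] (hP : IsEuclidean P) (b : P.Base)
    {w : EuclideanSpace ℝ (Fin n) ≃ₗ[ℝ] EuclideanSpace ℝ (Fin n)} (hw : w ∈ weylGroup b) :
    ∀ q ∈ dualRootLattice b, w q ∈ dualRootLattice b := by
  induction hw using Subgroup.closure_induction'' with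
  | one => exact fun q hq => hq
  | mem x hx =>
    obtain ⟨i, hi, rfl⟩ := hx
    exact fun q hq => reflection_mem_dualRootLattice hP b hi hq
  | inv_mem x hx =>
    obtain ⟨i, hi, rfl⟩ := hx
    rw [P.reflection_inv]
    exact fun q hq => reflection_mem_dualRootLattice hP b hi hq
  | mul x y _ _ hx hy => exact fun q hq => hx _ (hy q hq)

/-- For a subgroup `G` of the Weyl group, the semidirect product `Q^∨ ⋊ G`, realized as the group
of the affine maps `a ↦ w a + q` with `w ∈ G` and `q ∈ Q^∨`. -/
def affineGroup [P.IsCrystallographic] (hP : IsEuclidean P) (b : P.Base)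
    (G : Subgroup (EuclideanSpace ℝ (Fin n) ≃ₗ[ℝ] EuclideanSpace ℝ (Fin n)))
    (hG : G ≤ weylGroup b) :
    Subgroup (EuclideanSpace ℝ (Fin n) ≃ᵃ[ℝ] EuclideanSpace ℝ (Fin n)) where
  carrier := {g | ∃ w ∈ G, ∃ q ∈ dualRootLattice b, ∀ a, g a = w a + q}
  one_mem' := ⟨1, one_mem G, 0, zero_mem _, fun a => by simp⟩
  mul_mem' := by
    rintro g h ⟨w, hw, q, hq, hg⟩ ⟨w', hw', q', hq', hh⟩
    refine ⟨w * w', mul_mem hw hw', w q' + q,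
      add_mem (weylGroup_mem_dualRootLattice hP b (hG hw) q' hq') hq, fun a => ?_⟩
    rw [AffineEquiv.coe_mul, Function.comp_apply, hh, hg, map_add, LinearEquiv.mul_apply, add_assoc]
  inv_mem' := by
    rintro g ⟨w, hw, q, hq, hg⟩
    refine ⟨w⁻¹, inv_mem hw, -(w⁻¹ q),
      neg_mem (weylGroup_mem_dualRootLattice hP b (inv_mem (hG hw)) q hq), fun a => ?_⟩
    apply g.injective
    have h : g (g⁻¹ a) = a := g.apply_symm_apply a
    rw [h, hg, map_add, map_neg, ← LinearEquiv.mul_apply, ← LinearEquiv.mul_apply, mul_inv_cancel]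
    simp

/-- The affine Weyl group `W^aff = Q^∨ ⋊ W`. -/
def affineWeylGroup [P.IsCrystallographic] (hP : IsEuclidean P) (b : P.Base) :
    Subgroup (EuclideanSpace ℝ (Fin n) ≃ᵃ[ℝ] EuclideanSpace ℝ (Fin n)) :=
  affineGroup hP b (weylGroup b) le_rfl

/-- The even affine Weyl group `W^aff_e = Q^∨ ⋊ W^e`. -/
def evenAffineWeylGroup [P.IsCrystallographic] (hP : IsEuclidean P) (b : P.Base) :
    Subgroup (EuclideanSpace ℝ (Fin n) ≃ᵃ[ℝ] EuclideanSpace ℝ (Fin n)) :=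
  affineGroup hP b (evenWeylGroup b) (evenWeylGroup_le b)

/-- The isotropy group `{g ∈ G | g a = a}`. -/
def stab (G : Subgroup (EuclideanSpace ℝ (Fin n) ≃ᵃ[ℝ] EuclideanSpace ℝ (Fin n)))
    (a : EuclideanSpace ℝ (Fin n)) :
    Subgroup (EuclideanSpace ℝ (Fin n) ≃ᵃ[ℝ] EuclideanSpace ℝ (Fin n)) where
  carrier := {g | g ∈ G ∧ g a = a}
  one_mem' := ⟨one_mem G, rfl⟩
  mul_mem' := by
    rintro g h ⟨hg, hga⟩ ⟨hh, hha⟩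
    exact ⟨mul_mem hg hh, by rw [AffineEquiv.coe_mul, Function.comp_apply, hha, hga]⟩
  inv_mem' := by
    rintro g ⟨hg, hga⟩
    refine ⟨inv_mem hg, ?_⟩
    apply g.injective
    change g (g.symm a) = _
    simp [hga]

/-- The fundamental simplex `F = {a | ⟨a, α⟩ ≥ 0 for all simple roots α, ⟨a, ξ⟩ ≤ 1}`. -/
def fundamentalSimplex (b : P.Base) (ξ : ι) : Set (EuclideanSpace ℝ (Fin n)) :=
  {a | (∀ i ∈ b.support, 0 ≤ ⟪a, P.root i⟫_ℝ) ∧ ⟪a, P.root ξ⟫_ℝ ≤ 1}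

/-- The set `F^e = F ∪ r_j int(F)`. -/
def evenFundamentalRegion (b : P.Base) (ξ j : ι) : Set (EuclideanSpace ℝ (Fin n)) :=
  fundamentalSimplex b ξ ∪ P.reflection j '' interior (fundamentalSimplex b ξ)

end

end EvenAffineWeyl

end

open scoped InnerProductSpace

noncomputable section

/-! Everything reduces to the full affine Weyl group `W^aff`, for which `F` is a strict fundamental
domain with free action on `int(F)`; the even group is then handled by the sign homomorphism, the
determinant of the linear part.

For `W^aff`, existence is metric: the point of an orbit closest to an interior point of `F` lies in
`F`, since reflecting in a separating wall would bring it closer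
(`exists_apply_mem_fundamentalSimplex`). Uniqueness is combinatorial. The reflections in the walls
of `F` generate `W^aff` (`affineWeylGroup_le_closure`), and a hyperplane separating `F` from a
neighbour across a wall is that wall (`affineRoot_eq_of_separates`). This gives the exchange
condition, hence `eq_one_of_mem_openSimplex` and, by shortening words,
`apply_eq_of_mem_fundamentalSimplex`.

For the even group, an odd element carrying a point into `F` is corrected by a reflection: one
fixing the image if it is on the boundary, and `r_j` if it is interior. This is why `F^e` has a
second copy of the interior but not of the boundary. An odd element never maps `F` into `int(F)` at
any point, so the two copies stay inequivalent. On the boundary a reflection lies in the stabilizer,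
so its even part has index two. -/

namespace EvenAffineWeyl

/-! ### Words in involutions and the exchange condition -/

section Words

variable {G σ : Type*} [Group G] {s : σ → G}

/-- A half-space form of the exchange condition. -/
theorem exists_shorter_word (hs : ∀ t, s t * s t = 1) {A : σ → Set G} (h_one : ∀ t, 1 ∈ A t)
    (h_wall : ∀ (t u : σ) (l : List σ), (l.map s).prod ∈ A t → (l.map s).prod * s u ∉ A t →
      s t * (l.map s).prod = (l.map s).prod * s u)
    (t : σ) (l : List σ) (hl : (l.map s).prod ∉ A t) :
    ∃ l' : List σ, l'.length < l.length ∧ (l'.map s).prod = s t * (l.map s).prod := by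
  induction l using List.reverseRecOn with
  | nil => exact absurd (by simpa using h_one t) hl
  | append_singleton l u ih =>
    -- The prefixes of the word start inside `A t` and end outside. If the last letter makes the
    -- crossing, `h_wall` deletes it; otherwise the crossing is earlier and the last letter is
    -- carried along.
    by_cases h : (l.map s).prod ∈ A t
    · refine ⟨l, by simp, ?_⟩
      have := h_wall t u l h (by simpa using hl)
      simp [← mul_assoc, this]
      simp [mul_assoc, hs]
    · obtain ⟨l', h1, h2⟩ := ih h
      exact ⟨l' ++ [u], by simpa using h1, by simp [h2, mul_assoc]⟩

/-- Dropping the first letter `t` gives an element outside `A t`; exchange applied to that tail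
yields a strictly shorter word for the original element, so a descent on length ends at the empty
word. -/
theorem word_eq_one_of_mem_halfSpaces (hs : ∀ t, s t * s t = 1) {A : σ → Set G}
    (h_one : ∀ t, 1 ∈ A t) (h_neg : ∀ t g, g ∈ A t → s t * g ∉ A t)
    (h_wall : ∀ (t u : σ) (l : List σ), (l.map s).prod ∈ A t → (l.map s).prod * s u ∉ A t →
      s t * (l.map s).prod = (l.map s).prod * s u)
    (l : List σ) (hl : ∀ t, (l.map s).prod ∈ A t) : (l.map s).prod = 1 := by
  induction h : l.length using Nat.strong_induction_on generalizing l with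
  | _ N ih =>
    cases l with
    | nil => simp
    | cons t l =>
      have h1 := h_neg t _ (hl t)
      have h2 : s t * ((t :: l).map s).prod = (l.map s).prod := by simp [← mul_assoc, hs]
      rw [h2] at h1
      obtain ⟨l', h3, h4⟩ := exists_shorter_word hs h_one h_wall t l h1
      have h5 : ((t :: l).map s).prod = (l'.map s).prod := by simp [h4]
      rw [h5] at hl ⊢
      exact ih l'.length (by simp at h; omega) l' hl rfl

theorem exists_word_of_mem_closure (hs : ∀ t, s t * s t = 1) {g : G}
    (hg : g ∈ Subgroup.closure (Set.range s)) : ∃ l : List σ, (l.map s).prod = g := by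
  induction hg using Subgroup.closure_induction with
  | mem x hx => obtain ⟨t, rfl⟩ := hx; exact ⟨[t], by simp⟩
  | one => exact ⟨[], rfl⟩
  | mul x y _ _ hx hy =>
    obtain ⟨l, rfl⟩ := hx
    obtain ⟨m, rfl⟩ := hy
    exact ⟨l ++ m, by simp⟩
  | inv x _ hx =>
    obtain ⟨l, rfl⟩ := hx
    refine ⟨l.reverse, ?_⟩
    rw [List.prod_inv_reverse, List.map_map, List.map_reverse]
    congr 3
    funext t
    exact (inv_eq_of_mul_eq_one_left (hs t)).symm

end Words

/-! ### Euclidean root pairings: reflections and coroots -/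

variable {n : ℕ} {ι : Type*}
  {P : RootPairing ι ℝ (EuclideanSpace ℝ (Fin n)) (EuclideanSpace ℝ (Fin n))}

theorem IsEuclidean.inner_root_self_pos (i : ι) : 0 < ⟪P.root i, P.root i⟫_ℝ :=
  real_inner_self_pos.mpr (P.ne_zero i)

theorem IsEuclidean.reflection_apply (hP : IsEuclidean P) (i : ι) (x) :
    P.reflection i x = x - ⟪x, P.root i⟫_ℝ • P.coroot i := by
  have h : P.coroot' i x = ⟪x, P.coroot i⟫_ℝ := hP.pairing_eq _ _
  rw [P.reflection_apply, h, hP.coroot_eq i, inner_smul_right, smul_smul, mul_comm]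

theorem IsEuclidean.inner_coroot_root (hP : IsEuclidean P) (i : ι) :
    ⟪P.coroot i, P.root i⟫_ℝ = 2 := by
  have := (IsEuclidean.inner_root_self_pos (P := P) i).ne'
  rw [hP.coroot_eq, real_inner_smul_left]
  field_simp

theorem IsEuclidean.exists_int_inner (hP : IsEuclidean P) [P.IsCrystallographic] (i k : ι) :
    ∃ z : ℤ, ⟪P.coroot k, P.root i⟫_ℝ = z := by
  obtain ⟨z, hz⟩ := P.exists_value (S := ℤ) i k
  have h2 : P.pairing i k = ⟪P.root i, P.coroot k⟫_ℝ := hP.pairing_eq _ _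
  exact ⟨z, by rw [real_inner_comm, ← h2, ← hz]; simp⟩

theorem IsEuclidean.inner_coroot_eq (hP : IsEuclidean P) (i : ι) (x) :
    ⟪P.coroot i, x⟫_ℝ = 2 / ⟪P.root i, P.root i⟫_ℝ * ⟪P.root i, x⟫_ℝ := by
  rw [hP.coroot_eq, real_inner_smul_left]

theorem IsEuclidean.inner_reflection (hP : IsEuclidean P) (i : ι) (x y) :
    ⟪P.reflection i x, P.reflection i y⟫_ℝ = ⟪x, y⟫_ℝ := by
  have h0 := (IsEuclidean.inner_root_self_pos (P := P) i).ne'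
  simp only [hP.reflection_apply, inner_sub_left, inner_sub_right, real_inner_smul_left,
    real_inner_smul_right, hP.coroot_eq i]
  rw [real_inner_comm y (P.root i)]
  field_simp
  ring

/-- A reflection is a transvection `x ↦ x + f(x) v` with `f(v) = -2`, so its determinant is `1 +
f(v) = -1`. -/
theorem det_reflection (i : ι) : LinearEquiv.det (P.reflection i) = -1 := by
  ext
  rw [LinearEquiv.coe_det]
  have : (P.reflection i : EuclideanSpace ℝ (Fin n) →ₗ[ℝ] EuclideanSpace ℝ (Fin n)) =
      LinearMap.transvection (-P.coroot' i) (P.root i) := by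
    ext1 x
    simp [LinearMap.transvection.apply, P.reflection_apply, sub_eq_add_neg]
  rw [this, LinearMap.transvection.det]
  simp
  norm_num

/-! ### The Weyl group -/

/-- Every root is reached from a simple one by simple reflections and negation, and the reflection
in the image of a root under a reflection is a conjugate. -/
theorem reflection_mem_weylGroup [Finite ι] [P.IsCrystallographic] [P.IsReduced]
    (b : P.Base) (i : ι) : P.reflection i ∈ weylGroup b := by
  refine b.induction_reflect i (p := fun i => P.reflection i ∈ weylGroup b) (fun i hi => ?_)
    (fun i hi => Subgroup.subset_closure ⟨i, hi, rfl⟩) (fun i j hi hj => ?_)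
  · rw [P.reflection_reflectionPerm]
    exact mul_mem (mul_mem hi hi) hi
  · have hj' : P.reflection j ∈ weylGroup b := Subgroup.subset_closure ⟨j, hj, rfl⟩
    rw [P.reflection_reflectionPerm]
    exact mul_mem (mul_mem hj' hi) hj'

theorem weylGroup_inner (hP : IsEuclidean P) {b : P.Base}
    {w : EuclideanSpace ℝ (Fin n) ≃ₗ[ℝ] EuclideanSpace ℝ (Fin n)} (hw : w ∈ weylGroup b) :
    ∀ x y, ⟪w x, w y⟫_ℝ = ⟪x, y⟫_ℝ := by
  induction hw using Subgroup.closure_induction'' with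
  | one => exact fun x y => rfl
  | mem x hx =>
    obtain ⟨i, hi, rfl⟩ := hx
    exact hP.inner_reflection i
  | inv_mem x hx =>
    obtain ⟨i, hi, rfl⟩ := hx
    rw [P.reflection_inv]
    exact hP.inner_reflection i
  | mul x y _ _ hx hy => exact fun u v => (hx _ _).trans (hy u v)

theorem weylGroup_exists_root {b : P.Base}
    {w : EuclideanSpace ℝ (Fin n) ≃ₗ[ℝ] EuclideanSpace ℝ (Fin n)} (hw : w ∈ weylGroup b) :
    ∀ i, ∃ k, P.root k = w (P.root i) := by
  induction hw using Subgroup.closure_induction'' with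
  | one => exact fun i => ⟨i, rfl⟩
  | mem x hx =>
    obtain ⟨i, hi, rfl⟩ := hx
    exact fun k => ⟨_, P.root_reflectionPerm i k⟩
  | inv_mem x hx =>
    obtain ⟨i, hi, rfl⟩ := hx
    rw [P.reflection_inv]
    exact fun k => ⟨_, P.root_reflectionPerm i k⟩
  | mul x y _ _ hx hy =>
    intro i
    obtain ⟨k, hk⟩ := hy i
    obtain ⟨l, hl⟩ := hx k
    exact ⟨l, by rw [hl, hk]; rfl⟩

theorem weylGroup_coroot (hP : IsEuclidean P) {b : P.Base}
    {w : EuclideanSpace ℝ (Fin n) ≃ₗ[ℝ] EuclideanSpace ℝ (Fin n)} (hw : w ∈ weylGroup b)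
    {i k : ι} (h : P.root k = w (P.root i)) : P.coroot k = w (P.coroot i) := by
  rw [hP.coroot_eq, hP.coroot_eq, h, map_smul, weylGroup_inner hP hw]

theorem weylGroup_det {b : P.Base}
    {w : EuclideanSpace ℝ (Fin n) ≃ₗ[ℝ] EuclideanSpace ℝ (Fin n)} (hw : w ∈ weylGroup b) :
    LinearEquiv.det w = 1 ∨ LinearEquiv.det w = -1 := by
  induction hw using Subgroup.closure_induction with
  | one => left; exact map_one _
  | mem x hx =>
    obtain ⟨i, hi, rfl⟩ := hx
    exact Or.inr (det_reflection i)
  | inv x _ hx => rw [map_inv]; rcases hx with hx | hx <;> simp [hx]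
  | mul x y _ _ hx hy =>
    rw [map_mul]
    rcases hx with hx | hx <;> rcases hy with hy | hy <;> simp [hx, hy]

/-- Since the roots span, an element is determined by the map it induces on the finite index set. -/
theorem finite_weylGroup [Finite ι] [P.IsRootSystem] (b : P.Base) :
    (weylGroup b : Set (EuclideanSpace ℝ (Fin n) ≃ₗ[ℝ] EuclideanSpace ℝ (Fin n))).Finite := by
  choose f hf using fun w : weylGroup b => weylGroup_exists_root w.2
  have : Function.Injective f := by
    intro w w' h
    ext1
    apply LinearEquiv.toLinearMap_injective
    refine LinearMap.ext_on_range (v := P.root)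
      RootPairing.IsRootSystem.span_root_eq_top fun i => ?_
    have h1 := hf w i
    have h2 := hf w' i
    rw [h] at h1
    exact h1.symm.trans h2
  have := Finite.of_injective f this
  exact Set.toFinite _

/-! ### Geometry of the fundamental simplex -/

theorem inner_nonneg_of_mem_closure {b : P.Base} {x v : EuclideanSpace ℝ (Fin n)}
    (hx : ∀ i ∈ b.support, 0 ≤ ⟪x, P.root i⟫_ℝ)
    (hv : v ∈ AddSubmonoid.closure (P.root '' b.support)) : 0 ≤ ⟪x, v⟫_ℝ := by
  induction hv using AddSubmonoid.closure_induction with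
  | mem y hy => obtain ⟨i, hi, rfl⟩ := hy; exact hx i hi
  | zero => simp
  | add y z _ _ hy hz => rw [inner_add_right]; positivity

theorem inner_pos_of_mem_closure {b : P.Base} {x v : EuclideanSpace ℝ (Fin n)}
    (hx : ∀ i ∈ b.support, 0 < ⟪x, P.root i⟫_ℝ)
    (hv : v ∈ AddSubmonoid.closure (P.root '' b.support)) : v = 0 ∨ 0 < ⟪x, v⟫_ℝ := by
  induction hv using AddSubmonoid.closure_induction with
  | mem y hy => obtain ⟨i, hi, rfl⟩ := hy; exact Or.inr (hx i hi)
  | zero => simp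
  | add y z _ _ hy hz =>
    rcases hy with rfl | hy
    · simpa using hz
    · rcases hz with rfl | hz
      · simpa using Or.inr hy
      · right; rw [inner_add_right]; positivity

/-- On a facet of the dominant chamber only the multiples of one simple root vanish. -/
theorem eq_nsmul_or_inner_pos_of_mem_closure {b : P.Base} {x v : EuclideanSpace ℝ (Fin n)} {i : ι}
    (hi : ⟪x, P.root i⟫_ℝ = 0) (hx : ∀ k ∈ b.support, k ≠ i → 0 < ⟪x, P.root k⟫_ℝ)
    (hv : v ∈ AddSubmonoid.closure (P.root '' b.support)) :
    (∃ m : ℕ, v = m • P.root i) ∨ 0 < ⟪x, v⟫_ℝ := by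
  induction hv using AddSubmonoid.closure_induction with
  | mem y hy =>
    obtain ⟨k, hk, rfl⟩ := hy
    by_cases h : k = i
    · exact Or.inl ⟨1, by simp [h]⟩
    · exact Or.inr (hx k hk h)
  | zero => exact Or.inl ⟨0, by simp⟩
  | add y z _ _ hy hz =>
    rcases hy with ⟨m, rfl⟩ | hy
    · rcases hz with ⟨l, rfl⟩ | hz
      · exact Or.inl ⟨m + l, by rw [add_smul]⟩
      · right
        simpa [inner_add_right, hi, ← Nat.cast_smul_eq_nsmul ℝ, real_inner_smul_right] using hz
    · rcases hz with ⟨l, rfl⟩ | hz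
      · right
        simpa [inner_add_right, hi, ← Nat.cast_smul_eq_nsmul ℝ, real_inner_smul_right] using hy
      · right; rw [inner_add_right]; positivity

/-- The simple roots form a basis, so the prescribed values define a functional, which the scalar
product represents. It supplies the test points inside `F` and on its walls. -/
theorem exists_inner_simple_root_eq [P.IsRootSystem] (b : P.Base) (c : ι → ℝ) :
    ∃ p : EuclideanSpace ℝ (Fin n), ∀ i ∈ b.support, ⟪p, P.root i⟫_ℝ = c i := by
  let φ := b.toWeightBasis.constr ℝ (fun i : b.support => c i)
  refine ⟨(InnerProductSpace.toDual ℝ _).symm (LinearMap.toContinuousLinearMap φ), fun i hi => ?_⟩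
  rw [InnerProductSpace.toDual_symm_apply, LinearMap.coe_toContinuousLinearMap',
    ← b.toWeightBasis_apply ⟨i, hi⟩, Module.Basis.constr_basis]

/-- Comparing `ξ` with the root `-ξ`, whose index is `P.reflectionPerm ξ ξ`, shows that `2ξ` is a
nonnegative combination of simple roots. -/
theorem IsHighestRoot.inner_pos {b : P.Base} {ξ : ι} (hξ : IsHighestRoot b ξ)
    {x : EuclideanSpace ℝ (Fin n)} (hx : ∀ i ∈ b.support, 0 < ⟪x, P.root i⟫_ℝ) :
    0 < ⟪x, P.root ξ⟫_ℝ := by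
  have h := hξ (P.reflectionPerm ξ ξ)
  rw [P.root_reflectionPerm, P.reflection_apply_self, sub_neg_eq_add] at h
  rcases inner_pos_of_mem_closure hx h with h | h
  · rw [← two_smul ℝ, smul_eq_zero] at h
    exact absurd h (by simp [P.ne_zero ξ])
  · rw [inner_add_right] at h
    linarith

theorem IsHighestRoot.inner_nonneg {b : P.Base} {ξ : ι} (hξ : IsHighestRoot b ξ)
    {x : EuclideanSpace ℝ (Fin n)} (hx : ∀ i ∈ b.support, 0 ≤ ⟪x, P.root i⟫_ℝ) :
    0 ≤ ⟪x, P.root ξ⟫_ℝ := by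
  have h := hξ (P.reflectionPerm ξ ξ)
  rw [P.root_reflectionPerm, P.reflection_apply_self, sub_neg_eq_add] at h
  have h := inner_nonneg_of_mem_closure hx h
  rw [inner_add_right] at h
  linarith

theorem IsHighestRoot.inner_le {b : P.Base} {ξ : ι} (hξ : IsHighestRoot b ξ)
    {x : EuclideanSpace ℝ (Fin n)} (hx : ∀ i ∈ b.support, 0 ≤ ⟪x, P.root i⟫_ℝ) (i : ι) :
    ⟪x, P.root i⟫_ℝ ≤ ⟪x, P.root ξ⟫_ℝ := by
  have h := inner_nonneg_of_mem_closure hx (hξ i)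
  rw [inner_sub_right] at h
  linarith

theorem IsHighestRoot.eq_of_inner_le {b : P.Base} {ξ : ι} (hξ : IsHighestRoot b ξ)
    {x : EuclideanSpace ℝ (Fin n)} (hx : ∀ i ∈ b.support, 0 < ⟪x, P.root i⟫_ℝ) {i : ι}
    (hi : ⟪x, P.root ξ⟫_ℝ ≤ ⟪x, P.root i⟫_ℝ) : P.root i = P.root ξ := by
  rcases inner_pos_of_mem_closure hx (hξ i) with h | h
  · exact (sub_eq_zero.mp h).symm
  · rw [inner_sub_right] at h
    linarith

/-- The index `i` and the integer `k` define one of the walls of the fundamental simplex. -/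
def IsSimpleAffine (b : P.Base) (ξ i : ι) (k : ℤ) : Prop :=
  (i ∈ b.support ∧ k = 0) ∨ (P.root i = -P.root ξ ∧ k = 1)

/-- The points satisfying all the inequalities of the fundamental simplex strictly. -/
def openSimplex (b : P.Base) (ξ : ι) : Set (EuclideanSpace ℝ (Fin n)) :=
  {a | (∀ i ∈ b.support, 0 < ⟪a, P.root i⟫_ℝ) ∧ ⟪a, P.root ξ⟫_ℝ < 1}

/-- A nonzero linear functional is an open map, so taking interiors commutes with pulling back a
closed half-line. -/
theorem interior_fundamentalSimplex (b : P.Base) (ξ : ι) :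
    interior (fundamentalSimplex b ξ) = openSimplex b ξ := by
  have key : ∀ (i : ι), IsOpenMap (innerSL ℝ (P.root i)) := fun i =>
    ContinuousLinearMap.isOpenMap_of_ne_zero _ (by
      intro h
      have h1 := congrArg (fun f => f (P.root i)) h
      simp at h1
      exact P.ne_zero i h1)
  apply subset_antisymm
  · intro a ha
    refine ⟨fun i hi => ?_, ?_⟩
    · have h1 : a ∈ interior (innerSL ℝ (P.root i) ⁻¹' Set.Ici 0) :=
        interior_mono (fun x hx => by
          simpa [real_inner_comm] using hx.1 i hi) ha
      rw [← (key i).preimage_interior_eq_interior_preimage (by fun_prop), interior_Ici] at h1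
      simpa [real_inner_comm] using h1
    · have h1 : a ∈ interior (innerSL ℝ (P.root ξ) ⁻¹' Set.Iic 1) :=
        interior_mono (fun x hx => by
          simpa [real_inner_comm] using hx.2) ha
      rw [← (key ξ).preimage_interior_eq_interior_preimage (by fun_prop), interior_Iic] at h1
      simpa [real_inner_comm] using h1
  · refine interior_maximal (fun x hx => ⟨fun i hi => (hx.1 i hi).le, hx.2.le⟩) ?_
    have : openSimplex b ξ = (⋂ i ∈ b.support, {a | 0 < ⟪a, P.root i⟫_ℝ}) ∩
        {a | ⟪a, P.root ξ⟫_ℝ < 1} := by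
      ext; simp [openSimplex]
    rw [this]
    exact (isOpen_biInter_finset fun i _ => isOpen_lt (by fun_prop) (by fun_prop)).inter
      (isOpen_lt (by fun_prop) (by fun_prop))

theorem mem_fundamentalSimplex_iff {b : P.Base} {ξ : ι} {a : EuclideanSpace ℝ (Fin n)} :
    a ∈ fundamentalSimplex b ξ ↔ ∀ i k, IsSimpleAffine b ξ i k → 0 ≤ ⟪a, P.root i⟫_ℝ + k := by
  constructor
  · rintro ⟨h1, h2⟩ i k (⟨hi, rfl⟩ | ⟨hi, rfl⟩)
    · simpa using h1 i hi
    · simpa [hi] using h2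
  · intro h
    refine ⟨fun i hi => by simpa using h i 0 (Or.inl ⟨hi, rfl⟩), ?_⟩
    have h1 : P.root (P.reflectionPerm ξ ξ) = -P.root ξ := by
      rw [P.root_reflectionPerm, P.reflection_apply_self]
    simpa [h1] using h _ 1 (Or.inr ⟨h1, rfl⟩)

theorem mem_openSimplex_iff {b : P.Base} {ξ : ι} {a : EuclideanSpace ℝ (Fin n)} :
    a ∈ openSimplex b ξ ↔ ∀ i k, IsSimpleAffine b ξ i k → 0 < ⟪a, P.root i⟫_ℝ + k := by
  constructor
  · rintro ⟨h1, h2⟩ i k (⟨hi, rfl⟩ | ⟨hi, rfl⟩)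
    · simpa using h1 i hi
    · simpa [hi] using h2
  · intro h
    refine ⟨fun i hi => by simpa using h i 0 (Or.inl ⟨hi, rfl⟩), ?_⟩
    have h1 : P.root (P.reflectionPerm ξ ξ) = -P.root ξ := by
      rw [P.root_reflectionPerm, P.reflection_apply_self]
    simpa [h1] using h _ 1 (Or.inr ⟨h1, rfl⟩)

theorem openSimplex_subset (b : P.Base) (ξ : ι) : openSimplex b ξ ⊆ fundamentalSimplex b ξ :=
  fun _ hx => ⟨fun i hi => (hx.1 i hi).le, hx.2.le⟩

theorem openSimplex_nonempty [P.IsRootSystem] {b : P.Base} {ξ : ι} (hξ : IsHighestRoot b ξ) :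
    (openSimplex b ξ).Nonempty := by
  obtain ⟨p, hp⟩ := exists_inner_simple_root_eq b (fun _ => 1)
  have hp' : ∀ i ∈ b.support, 0 < ⟪p, P.root i⟫_ℝ := fun i hi => by rw [hp i hi]; exact one_pos
  have h := hξ.inner_pos hp'
  -- With `c = ⟨p, ξ⟩ > 0`, this scaling makes the value at `ξ` equal to `c / (c + 1) < 1`.
  refine ⟨(1 / (⟪p, P.root ξ⟫_ℝ + 1)) • p, fun i hi => ?_, ?_⟩
  · rw [real_inner_smul_left, hp i hi]; positivity
  · rw [real_inner_smul_left, one_div, inv_mul_lt_one₀ (by positivity)]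
    linarith

/-- An affine root does not change sign on the fundamental simplex. -/
theorem affineRoot_nonneg {b : P.Base} {ξ : ι} (hξ : IsHighestRoot b ξ)
    {x y : EuclideanSpace ℝ (Fin n)} (hx : x ∈ openSimplex b ξ) (hy : y ∈ fundamentalSimplex b ξ)
    {i : ι} {k : ℤ} (h : 0 ≤ ⟪x, P.root i⟫_ℝ + k) : 0 ≤ ⟪y, P.root i⟫_ℝ + k := by
  have hx' := openSimplex_subset b ξ hx
  -- Integrality of `k` is decisive. A positive root is below `1` at `x`, so `k > -1` gives `k ≥ 0`;
  -- a negative root is below `0` at `x`, so `k ≥ 1`, while it is at least `-1` on `F`.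
  rcases b.root_mem_or_neg_mem i with hi | hi
  · have h1 := (hξ.inner_le hx'.1 i).trans_lt hx.2
    have hk : (-1 : ℝ) < k := by linarith
    have hk : (0 : ℤ) ≤ k := by
      have : (-1 : ℤ) < k := by exact_mod_cast hk
      omega
    have hk : (0 : ℝ) ≤ k := by exact_mod_cast hk
    have := inner_nonneg_of_mem_closure hy.1 hi
    linarith
  · have h1 : 0 < ⟪x, -P.root i⟫_ℝ :=
      (inner_pos_of_mem_closure hx.1 hi).resolve_left (neg_ne_zero.mpr (P.ne_zero i))
    rw [inner_neg_right] at h1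
    have hk : (0 : ℝ) < k := by linarith
    have hk : (1 : ℤ) ≤ k := by exact_mod_cast hk
    have hk : (1 : ℝ) ≤ k := by exact_mod_cast hk
    have := (hξ.inner_le hy.1 (P.reflectionPerm i i)).trans hy.2
    rw [P.root_reflectionPerm, P.reflection_apply_self, inner_neg_right] at this
    linarith

theorem affineRoot_nonpos {b : P.Base} {ξ : ι} (hξ : IsHighestRoot b ξ)
    {x y : EuclideanSpace ℝ (Fin n)} (hx : x ∈ openSimplex b ξ) (hy : y ∈ fundamentalSimplex b ξ)
    {i : ι} {k : ℤ} (h : ⟪x, P.root i⟫_ℝ + k ≤ 0) : ⟪y, P.root i⟫_ℝ + k ≤ 0 := by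
  have h1 : 0 ≤ ⟪x, P.root (P.reflectionPerm i i)⟫_ℝ + (-k : ℤ) := by
    rw [P.root_reflectionPerm, P.reflection_apply_self, inner_neg_right]
    push_cast
    linarith
  have h2 := affineRoot_nonneg hξ hx hy h1
  rw [P.root_reflectionPerm, P.reflection_apply_self, inner_neg_right] at h2
  push_cast at h2
  linarith

/-- Every wall of the fundamental simplex contains a point of the simplex which lies on no other
affine root hyperplane. -/
theorem exists_wall_point [Finite ι] [P.IsRootSystem] {b : P.Base} {ξ : ι}
    (hξ : IsHighestRoot b ξ) {i : ι} {k : ℤ} (hik : IsSimpleAffine b ξ i k) :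
    ∃ p ∈ fundamentalSimplex b ξ, ⟪p, P.root i⟫_ℝ + k = 0 ∧
      ∀ (l : ι) (m : ℤ), ⟪p, P.root l⟫_ℝ + m = 0 →
        (P.root l = P.root i ∧ m = k) ∨ (P.root l = -P.root i ∧ m = -k) := by
  -- An affine root and its negative vanish together, so positive roots suffice.
  suffices h : ∃ p ∈ fundamentalSimplex b ξ, ⟪p, P.root i⟫_ℝ + k = 0 ∧
      ∀ (l : ι) (m : ℤ), P.root l ∈ AddSubmonoid.closure (P.root '' b.support) →
        ⟪p, P.root l⟫_ℝ + m = 0 →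
        (P.root l = P.root i ∧ m = k) ∨ (P.root l = -P.root i ∧ m = -k) by
    obtain ⟨p, hp, hpi, h⟩ := h
    refine ⟨p, hp, hpi, fun l m hlm => ?_⟩
    rcases b.root_mem_or_neg_mem l with hl | hl
    · exact h l m hl hlm
    · have h1 : P.root (P.reflectionPerm l l) = -P.root l := by
        rw [P.root_reflectionPerm, P.reflection_apply_self]
      rcases h (P.reflectionPerm l l) (-m) (by rwa [h1])
        (by rw [h1, inner_neg_right]; push_cast; linarith) with ⟨h2, h3⟩ | ⟨h2, h3⟩
      · exact Or.inr ⟨by rw [← h2, h1, neg_neg], by omega⟩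
      · exact Or.inl ⟨by rwa [h1, neg_inj] at h2, by omega⟩
  classical
  rcases hik with ⟨hi, rfl⟩ | ⟨hi, rfl⟩
  -- Only the wall of `α_i` contains `q`, and dividing by `c + 1` keeps the point off the wall of
  -- `ξ`. Here `c` may vanish: in rank one `q = 0`. Positive roots take values in `[0, 1)` at `p`,
  -- so `m = 0`, and those vanishing there are multiples of `α_i`.
  · obtain ⟨q, hq⟩ := exists_inner_simple_root_eq b (fun l => if l = i then 0 else 1)
    have hq0 : ∀ l ∈ b.support, 0 ≤ ⟪q, P.root l⟫_ℝ := fun l hl => by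
      rw [hq l hl]; split_ifs <;> norm_num
    have hc := hξ.inner_nonneg hq0
    set c := ⟪q, P.root ξ⟫_ℝ with hc_def
    let p := (1 / (c + 1)) • q
    have hpv : ∀ v, ⟪p, v⟫_ℝ = 1 / (c + 1) * ⟪q, v⟫_ℝ := fun v => real_inner_smul_left _ _ _
    have hp0 : ∀ l ∈ b.support, 0 ≤ ⟪p, P.root l⟫_ℝ := fun l hl => by
      rw [hpv]; exact mul_nonneg (by positivity) (hq0 l hl)
    have hpξ : ⟪p, P.root ξ⟫_ℝ < 1 := by
      rw [hpv, ← hc_def, one_div, inv_mul_lt_one₀ (by positivity)]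
      linarith
    have hpi : ⟪p, P.root i⟫_ℝ = 0 := by rw [hpv, hq i hi]; simp
    refine ⟨p, ⟨hp0, hpξ.le⟩, by simp [hpi], fun l m hl hlm => ?_⟩
    have h1 := inner_nonneg_of_mem_closure hp0 hl
    have h2 := (hξ.inner_le hp0 l).trans_lt hpξ
    have h3 : ((-1 : ℤ) : ℝ) < m := by push_cast; linarith
    have h4 : (m : ℝ) ≤ (0 : ℤ) := by push_cast; linarith
    have h3 := Int.cast_lt.mp h3
    have h4 := Int.cast_le.mp h4
    obtain rfl : m = 0 := by omega
    rcases eq_nsmul_or_inner_pos_of_mem_closure (x := p) hpi (fun l hl hli => by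
      rw [hpv, hq l hl, if_neg hli]; positivity) hl with ⟨r, hr⟩ | h
    · have : IsAddTorsionFree (EuclideanSpace ℝ (Fin n)) := .of_isTorsionFree ℝ _
      rcases b.eq_one_or_neg_one_of_mem_support_of_smul_mem i hi (r : ℝ)
        ⟨l, by rw [hr, Nat.cast_smul_eq_nsmul]⟩ with h | h
      · left; exact ⟨by rw [hr, ← Nat.cast_smul_eq_nsmul ℝ, h, one_smul], rfl⟩
      · right; exact ⟨by rw [hr, ← Nat.cast_smul_eq_nsmul ℝ, h, neg_one_smul], rfl⟩
    · simp at hlm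
      exact absurd hlm h.ne'
  -- A strictly dominant point scaled to `⟨p, ξ⟩ = 1`. Positive roots take values in `(0, 1]` there,
  -- which forces `m = -1`, and the value `1` is attained only by `ξ`.
  · obtain ⟨q, hq⟩ := exists_inner_simple_root_eq b (fun _ => 1)
    have hq' : ∀ i ∈ b.support, 0 < ⟪q, P.root i⟫_ℝ := fun i hi => by rw [hq i hi]; exact one_pos
    have hc := hξ.inner_pos hq'
    set c := ⟪q, P.root ξ⟫_ℝ with hc_def
    let p := (1 / c) • q
    have hpv : ∀ v, ⟪p, v⟫_ℝ = 1 / c * ⟪q, v⟫_ℝ := fun v => real_inner_smul_left _ _ _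
    have hp0 : ∀ l ∈ b.support, 0 < ⟪p, P.root l⟫_ℝ := fun l hl => by
      rw [hpv]; exact mul_pos (by positivity) (hq' l hl)
    have hpξ : ⟪p, P.root ξ⟫_ℝ = 1 := by
      rw [hpv, ← hc_def, one_div, inv_mul_cancel₀ hc.ne']
    refine ⟨p, ⟨fun l hl => (hp0 l hl).le, hpξ.le⟩, by rw [hi, inner_neg_right, hpξ]; simp,
      fun l m hl hlm => ?_⟩
    have h1 := (inner_pos_of_mem_closure hp0 hl).resolve_left (P.ne_zero l)
    have h2 := hξ.inner_le (fun l hl => (hp0 l hl).le) l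
    have h3 : ((-1 : ℤ) : ℝ) ≤ m := by push_cast; linarith
    have h4 : (m : ℝ) < (0 : ℤ) := by push_cast; linarith
    have h3 := Int.cast_le.mp h3
    have h4 := Int.cast_lt.mp h4
    obtain rfl : m = -1 := by omega
    push_cast at hlm
    right
    exact ⟨by rw [hi, neg_neg]; exact hξ.eq_of_inner_le hp0 (by linarith), rfl⟩

/-! ### Affine reflections -/

/-- The affine map `x ↦ w x + q`. -/
def affineMotion (w : EuclideanSpace ℝ (Fin n) ≃ₗ[ℝ] EuclideanSpace ℝ (Fin n))
    (q : EuclideanSpace ℝ (Fin n)) : EuclideanSpace ℝ (Fin n) ≃ᵃ[ℝ] EuclideanSpace ℝ (Fin n) :=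
  AffineEquiv.constVAdd ℝ _ q * w.toAffineEquiv

theorem affineMotion_apply (w : EuclideanSpace ℝ (Fin n) ≃ₗ[ℝ] EuclideanSpace ℝ (Fin n))
    (q x : EuclideanSpace ℝ (Fin n)) : affineMotion w q x = w x + q :=
  add_comm _ _

/-- The orthogonal reflection in the hyperplane `⟨x, α_i⟩ + k = 0`. -/
def affReflection (P : RootPairing ι ℝ (EuclideanSpace ℝ (Fin n)) (EuclideanSpace ℝ (Fin n)))
    (i : ι) (k : ℤ) : EuclideanSpace ℝ (Fin n) ≃ᵃ[ℝ] EuclideanSpace ℝ (Fin n) :=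
  affineMotion (P.reflection i) (-(k • P.coroot i))

theorem affReflection_apply (hP : IsEuclidean P) (i : ι) (k : ℤ) (x) :
    affReflection P i k x = x - (⟪x, P.root i⟫_ℝ + k) • P.coroot i := by
  rw [affReflection, affineMotion_apply, hP.reflection_apply, ← Int.cast_smul_eq_zsmul ℝ k]
  module

theorem inner_affReflection (hP : IsEuclidean P) (i : ι) (k : ℤ) (x) :
    ⟪affReflection P i k x, P.root i⟫_ℝ + k = -(⟪x, P.root i⟫_ℝ + k) := by
  rw [affReflection_apply hP, inner_sub_left, real_inner_smul_left, hP.inner_coroot_root]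
  ring

theorem affReflection_mul_self (hP : IsEuclidean P) (i : ι) (k : ℤ) :
    affReflection P i k * affReflection P i k = 1 := by
  ext1 x
  change affReflection P i k (affReflection P i k x) = x
  rw [affReflection_apply hP, inner_affReflection hP, affReflection_apply hP]
  module

theorem affReflection_apply_of_eq_zero (hP : IsEuclidean P) {i : ι} {k : ℤ} {x}
    (h : ⟪x, P.root i⟫_ℝ + k = 0) : affReflection P i k x = x := by
  rw [affReflection_apply hP, h, zero_smul, sub_zero]

/-- Reflecting across a hyperplane which separates `x` from `y` brings `x` closer to `y`. -/
theorem norm_affReflection_sub_lt (hP : IsEuclidean P) {i : ι} {k : ℤ} {x y}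
    (hx : ⟪x, P.root i⟫_ℝ + k < 0) (hy : 0 < ⟪y, P.root i⟫_ℝ + k) :
    ‖affReflection P i k x - y‖ < ‖x - y‖ := by
  have h0 := IsEuclidean.inner_root_self_pos (P := P) i
  refine lt_of_pow_lt_pow_left₀ 2 (norm_nonneg _) ?_
  have h1 : affReflection P i k x - y = (x - y) - (⟪x, P.root i⟫_ℝ + k) • P.coroot i := by
    rw [affReflection_apply hP]; abel
  rw [h1, ← real_inner_self_eq_norm_sq, ← real_inner_self_eq_norm_sq, real_inner_sub_sub_self]
  have h2 : ⟪x - y, P.root i⟫_ℝ = (⟪x, P.root i⟫_ℝ + k) - (⟪y, P.root i⟫_ℝ + k) := by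
    rw [inner_sub_left]; ring
  simp only [real_inner_smul_left, real_inner_smul_right, hP.coroot_eq i, h2]
  set a := ⟪x, P.root i⟫_ℝ + k
  set c := ⟪y, P.root i⟫_ℝ + k
  set r := ⟪P.root i, P.root i⟫_ℝ
  -- The squared distance changes by `4ac / r`, negative because `a` and `c` have opposite signs.
  have h3 : -2 * (a * (2 / r * (a - c))) + a * (2 / r * (a * (2 / r * r))) = 4 / r * (a * c) := by
    field_simp; ring
  have h4 : 4 / r * (a * c) < 0 :=
    mul_neg_of_pos_of_neg (by positivity) (mul_neg_of_neg_of_pos hx hy)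
  linarith

theorem exists_int_inner_of_mem_dualRootLattice (hP : IsEuclidean P) [P.IsCrystallographic]
    {b : P.Base} {q} (hq : q ∈ dualRootLattice b) (i : ι) : ∃ z : ℤ, ⟪q, P.root i⟫_ℝ = z := by
  induction hq using AddSubgroup.closure_induction with
  | mem x hx => obtain ⟨k, _, rfl⟩ := hx; exact hP.exists_int_inner i k
  | zero => exact ⟨0, by simp⟩
  | add x y _ _ hx hy =>
    obtain ⟨u, hu⟩ := hx
    obtain ⟨v, hv⟩ := hy
    exact ⟨u + v, by rw [inner_add_left, hu, hv]; simp⟩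
  | neg x _ hx =>
    obtain ⟨u, hu⟩ := hx
    exact ⟨-u, by rw [inner_neg_left, hu]; simp⟩

/-- The affine Weyl group permutes the affine roots and, compatibly, their reflections. -/
theorem exists_affineRoot_comp (hP : IsEuclidean P) [P.IsCrystallographic] {b : P.Base}
    {g : EuclideanSpace ℝ (Fin n) ≃ᵃ[ℝ] EuclideanSpace ℝ (Fin n)}
    (hg : g ∈ affineWeylGroup hP b) (i : ι) (k : ℤ) :
    ∃ (l : ι) (m : ℤ), (∀ x, ⟪g x, P.root i⟫_ℝ + k = ⟪x, P.root l⟫_ℝ + m) ∧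
      affReflection P i k * g = g * affReflection P l m := by
  obtain ⟨w, hw, q, hq, hg⟩ := hg
  obtain ⟨l, hl⟩ := weylGroup_exists_root (inv_mem hw) i
  obtain ⟨z, hz⟩ := exists_int_inner_of_mem_dualRootLattice hP hq i
  have hl' : P.root i = w (P.root l) := by
    rw [hl, ← LinearEquiv.mul_apply, mul_inv_cancel]; rfl
  have h : ∀ x, ⟪g x, P.root i⟫_ℝ + k = ⟪x, P.root l⟫_ℝ + (z + k : ℤ) := fun x => by
    rw [hg, inner_add_left, hz, hl', weylGroup_inner hP hw]
    push_cast
    ring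
  refine ⟨l, z + k, h, ?_⟩
  ext1 x
  change affReflection P i k (g x) = g (affReflection P l (z + k) x)
  rw [affReflection_apply hP, affReflection_apply hP, h, hg, hg, map_sub, map_smul,
    weylGroup_coroot hP hw hl']
  abel

/-! ### Generation by the simple affine reflections -/

theorem coroot_mem_dualRootLattice (b : P.Base) (i : ι) : P.coroot i ∈ dualRootLattice b := by
  have h := b.coroot_mem_span_int i
  rwa [← Submodule.mem_toAddSubgroup, Submodule.span_int_eq_addSubgroupClosure] at h

theorem affReflection_mem [Finite ι] (hP : IsEuclidean P) [P.IsCrystallographic] [P.IsReduced]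
    (b : P.Base) (i : ι) (k : ℤ) : affReflection P i k ∈ affineWeylGroup hP b :=
  ⟨P.reflection i, reflection_mem_weylGroup b i, _,
    neg_mem (zsmul_mem (coroot_mem_dualRootLattice b i) k), fun a => affineMotion_apply _ _ a⟩

/-- The reflections in the walls of the fundamental simplex. -/
def simpleAffineReflection (b : P.Base) (ξ : ι)
    (t : {p : ι × ℤ // IsSimpleAffine b ξ p.1 p.2}) :
    EuclideanSpace ℝ (Fin n) ≃ᵃ[ℝ] EuclideanSpace ℝ (Fin n) :=
  affReflection P t.1.1 t.1.2

theorem toAffineEquiv_mem_closure {b : P.Base} (ξ : ι)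
    {w : EuclideanSpace ℝ (Fin n) ≃ₗ[ℝ] EuclideanSpace ℝ (Fin n)} (hw : w ∈ weylGroup b) :
    w.toAffineEquiv ∈ Subgroup.closure (Set.range (simpleAffineReflection b ξ)) := by
  induction hw using Subgroup.closure_induction with
  | one => exact one_mem _
  | mem x hx =>
    obtain ⟨i, hi, rfl⟩ := hx
    refine Subgroup.subset_closure ⟨⟨(i, 0), Or.inl ⟨hi, rfl⟩⟩, ?_⟩
    ext1 x
    simp [simpleAffineReflection, affReflection, affineMotion_apply]
  | inv x _ hx => exact inv_mem hx
  | mul x y _ _ hx hy => exact mul_mem hx hy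

/-- Only `±ξ` have pairing of absolute value greater than one with the highest root `ξ`. -/
theorem IsHighestRoot.inner_coroot_cases [P.IsRootSystem] [P.IsCrystallographic]
    (hP : IsEuclidean P) {b : P.Base} {ξ : ι} (hξ : IsHighestRoot b ξ) (i : ι) :
    P.root i = P.root ξ ∨ P.root i = -P.root ξ ∨ ∃ z : ℤ, ⟪P.coroot ξ, P.root i⟫_ℝ = z ∧
      (z = 0 ∨ z = 1 ∨ z = -1) := by
  obtain ⟨x, hx⟩ := openSimplex_nonempty hξ
  have hpos := hξ.inner_pos hx.1
  -- If the pairing is `z ≥ 2`, then `zξ - α`, the negative of the reflection of `α` in `ξ`, is a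
  -- root. It is at most `ξ` on the dominant point `x`, whence `⟨x, α⟩ ≥ (z - 1)⟨x, ξ⟩ ≥ ⟨x, ξ⟩`.
  have key : ∀ i, (2 : ℝ) ≤ ⟪P.coroot ξ, P.root i⟫_ℝ → P.root i = P.root ξ := by
    intro i hi
    apply hξ.eq_of_inner_le hx.1
    have h1 := hξ.inner_le (fun i hi => (hx.1 i hi).le) (P.reflectionPerm ξ (P.reflectionPerm i i))
    have h2 : P.root (P.reflectionPerm ξ (P.reflectionPerm i i)) =
        ⟪P.coroot ξ, P.root i⟫_ℝ • P.root ξ - P.root i := by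
      have h3 : P.coroot' ξ (P.root i) = ⟪P.root i, P.coroot ξ⟫_ℝ := hP.pairing_eq _ _
      rw [P.root_reflectionPerm, P.root_reflectionPerm, P.reflection_apply_self, map_neg,
        P.reflection_apply, h3, real_inner_comm]
      abel
    rw [h2, inner_sub_right, real_inner_smul_right] at h1
    nlinarith
  obtain ⟨z, hz⟩ := hP.exists_int_inner i ξ
  by_cases h2 : 2 ≤ z
  · left; apply key; rw [hz]; exact_mod_cast h2
  by_cases h3 : z ≤ -2
  · right; left
    have h4 := key (P.reflectionPerm i i) (by
      rw [P.root_reflectionPerm, P.reflection_apply_self, inner_neg_right, hz]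
      have : (z : ℝ) ≤ (-2 : ℤ) := by exact_mod_cast h3
      push_cast at this
      linarith)
    rw [P.root_reflectionPerm, P.reflection_apply_self] at h4
    rw [← h4, neg_neg]
  · exact Or.inr (Or.inr ⟨z, hz, by omega⟩)

/-- The orbit of `ξ` spans a nonzero subspace stable under all reflections, which is everything by
irreducibility; it cannot be orthogonal to a root. -/
theorem exists_weylGroup_inner_ne_zero [Finite ι] [P.IsCrystallographic] [P.IsReduced]
    [P.IsIrreducible] (b : P.Base) (ξ i : ι) :
    ∃ w ∈ weylGroup b, ⟪w (P.root ξ), P.root i⟫_ℝ ≠ 0 := by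
  by_contra! h
  let U : Submodule ℝ (EuclideanSpace ℝ (Fin n)) :=
    Submodule.span ℝ {v | ∃ w ∈ weylGroup b, v = w (P.root ξ)}
  have hmem : P.root ξ ∈ U := Submodule.subset_span ⟨1, one_mem _, rfl⟩
  have hU : U = ⊤ := by
    refine RootPairing.IsIrreducible.eq_top_of_invtSubmodule_reflection (P := P) U (fun k => ?_) ?_
    · rw [Module.End.mem_invtSubmodule]
      refine Submodule.span_le.mpr ?_
      rintro v ⟨w, hw, rfl⟩
      exact Submodule.subset_span ⟨P.reflection k * w,
        mul_mem (reflection_mem_weylGroup b k) hw, rfl⟩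
    · intro h0
      rw [h0, Submodule.mem_bot] at hmem
      exact P.ne_zero ξ hmem
  have hle : U ≤ LinearMap.ker (innerSL ℝ (P.root i)).toLinearMap := by
    refine Submodule.span_le.mpr ?_
    rintro v ⟨w, hw, rfl⟩
    simpa [real_inner_comm] using h w hw
  have h1 : P.root i ∈ U := hU ▸ Submodule.mem_top
  have h2 : ⟪P.root i, P.root i⟫_ℝ = 0 := hle h1
  exact (IsEuclidean.inner_root_self_pos (P := P) i).ne' h2

/-- Translation by `ξ^∨` is the reflection in `⟨x, ξ⟩ = 1` after `r_ξ`. The vectors whose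
translations lie in the generated group form a subgroup `T`, stable under `W` by conjugation, so it
remains to reach every simple coroot from `ξ^∨`. -/
theorem constVAdd_mem_closure [Finite ι] [P.IsRootSystem] [P.IsCrystallographic] [P.IsReduced]
    [P.IsIrreducible] (hP : IsEuclidean P) {b : P.Base} {ξ : ι} (hξ : IsHighestRoot b ξ)
    {q} (hq : q ∈ dualRootLattice b) :
    AffineEquiv.constVAdd ℝ (EuclideanSpace ℝ (Fin n)) q ∈
      Subgroup.closure (Set.range (simpleAffineReflection b ξ)) := by
  let W' := Subgroup.closure (Set.range (simpleAffineReflection b ξ))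
  let T : AddSubgroup (EuclideanSpace ℝ (Fin n)) :=
    (W'.comap (AffineEquiv.constVAddHom ℝ (EuclideanSpace ℝ (Fin n)))).toAddSubgroup'
  have hT : ∀ v, v ∈ T ↔ AffineEquiv.constVAdd ℝ (EuclideanSpace ℝ (Fin n)) v ∈ W' :=
    fun v => Iff.rfl
  have hξT : P.coroot ξ ∈ T := by
    have h1 : P.root (P.reflectionPerm ξ ξ) = -P.root ξ := by
      rw [P.root_reflectionPerm, P.reflection_apply_self]
    have h2 : P.coroot (P.reflectionPerm ξ ξ) = -P.coroot ξ := by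
      rw [hP.coroot_eq, h1, hP.coroot_eq]; simp
    have h3 : affReflection P (P.reflectionPerm ξ ξ) 1 ∈ W' :=
      Subgroup.subset_closure ⟨⟨(_, 1), Or.inr ⟨h1, rfl⟩⟩, rfl⟩
    have h4 := toAffineEquiv_mem_closure ξ (reflection_mem_weylGroup b ξ)
    rw [hT]
    convert mul_mem h3 h4
    ext1 x
    change P.coroot ξ + x = affReflection P _ 1 (P.reflection ξ x)
    rw [affReflection_apply hP, h1, h2, inner_neg_right, hP.reflection_apply, inner_sub_left,
      real_inner_smul_left, hP.inner_coroot_root]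
    push_cast
    module
  have hwT : ∀ w ∈ weylGroup b, ∀ v ∈ T, w v ∈ T := by
    intro w hw v hv
    have h1 := toAffineEquiv_mem_closure ξ hw
    rw [hT] at hv ⊢
    convert mul_mem (mul_mem h1 hv) (inv_mem h1)
    ext1 x
    change w v + x = w (v + w.symm x)
    simp
  refine (AddSubgroup.closure_le T).mpr ?_ hq
  rintro _ ⟨i, hi, rfl⟩
  -- Replace `α_i` by a root `α_k` in its orbit that is not orthogonal to `ξ`.
  obtain ⟨w, hw, hne⟩ := exists_weylGroup_inner_ne_zero b ξ i
  obtain ⟨k, hk⟩ := weylGroup_exists_root (inv_mem hw) i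
  have hk' : P.root i = w (P.root k) := by
    rw [hk, ← LinearEquiv.mul_apply, mul_inv_cancel]; rfl
  change P.coroot i ∈ T
  rw [weylGroup_coroot hP hw hk']
  apply hwT w hw
  rcases hξ.inner_coroot_cases hP k with h | h | ⟨z, hz, h⟩
  · rw [hP.coroot_eq, h, ← hP.coroot_eq]; exact hξT
  · have : P.coroot k = -P.coroot ξ := by
      rw [hP.coroot_eq, h, hP.coroot_eq]; simp
    rw [this]
    exact neg_mem hξT
  -- This difference is `⟨ξ^∨, α_k⟩ α_k^∨`, which is `±α_k^∨` because the pairing is `±1`.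
  · have h1 : P.coroot ξ - P.reflection k (P.coroot ξ) ∈ T :=
      sub_mem hξT (hwT _ (reflection_mem_weylGroup b k) _ hξT)
    rw [hP.reflection_apply, hz, sub_sub_cancel] at h1
    rcases h with rfl | rfl | rfl
    · rw [hk', weylGroup_inner hP hw] at hne
      rw [hP.inner_coroot_eq] at hz
      exact absurd (by simpa [hne] using hz) (P.ne_zero ξ)
    · simpa using h1
    · simpa using h1

theorem affineWeylGroup_le_closure [Finite ι] [P.IsRootSystem] [P.IsCrystallographic]
    [P.IsReduced] [P.IsIrreducible] (hP : IsEuclidean P) {b : P.Base} {ξ : ι}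
    (hξ : IsHighestRoot b ξ) :
    affineWeylGroup hP b ≤ Subgroup.closure (Set.range (simpleAffineReflection b ξ)) := by
  rintro g ⟨w, hw, q, hq, hg⟩
  convert mul_mem (constVAdd_mem_closure hP hξ hq) (toAffineEquiv_mem_closure ξ hw)
  ext1 x
  rw [hg]
  exact (affineMotion_apply w q x).symm

/-! ### The fundamental simplex as a fundamental domain of the affine Weyl group -/

/-- If the hyperplane of an affine root separates the fundamental simplex from its mirror image in
one of its walls, then it is the hyperplane of this wall. -/
theorem affineRoot_eq_of_separates [Finite ι] [P.IsRootSystem] [P.IsCrystallographic]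
    [P.IsReduced] (hP : IsEuclidean P) {b : P.Base} {ξ : ι} (hξ : IsHighestRoot b ξ)
    {x : EuclideanSpace ℝ (Fin n)} (hx : x ∈ openSimplex b ξ) {i l : ι} {k m : ℤ}
    (hik : IsSimpleAffine b ξ i k) (hpos : 0 < ⟪x, P.root l⟫_ℝ + m)
    (hneg : ⟪affReflection P i k x, P.root l⟫_ℝ + m ≤ 0) : l = i ∧ m = k := by
  -- The wall point `p` belongs both to `F` and to its mirror image, so an affine root separating
  -- the two vanishes at `p`. It is then the root of the wall up to sign, and positivity at `x`
  -- fixes the sign.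
  obtain ⟨p, hpF, hp, huniq⟩ := exists_wall_point hξ hik
  have h1 := affineRoot_nonneg hξ hx hpF hpos.le
  obtain ⟨l', m', hlm, -⟩ := exists_affineRoot_comp hP (affReflection_mem hP b i k) l m
  rw [hlm] at hneg
  have h2 := affineRoot_nonpos hξ hx hpF hneg
  rw [← hlm, affReflection_apply_of_eq_zero hP hp] at h2
  rcases huniq l m (le_antisymm h2 h1) with ⟨h3, h4⟩ | ⟨h3, h4⟩
  · exact ⟨P.root.injective h3, h4⟩
  · have h5 := mem_openSimplex_iff.mp hx i k hik
    rw [h3, h4, inner_neg_right] at hpos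
    push_cast at hpos
    linarith

theorem simpleAffineReflection_mul_self (hP : IsEuclidean P) {b : P.Base} {ξ : ι} (t) :
    simpleAffineReflection b ξ t * simpleAffineReflection b ξ t = 1 :=
  affReflection_mul_self hP _ _

theorem simpleAffineWord_mem [Finite ι] [P.IsCrystallographic] [P.IsReduced] (hP : IsEuclidean P)
    (b : P.Base) (ξ : ι) (l) :
    (List.map (simpleAffineReflection b ξ) l).prod ∈ affineWeylGroup hP b :=
  list_prod_mem fun g hg => by
    obtain ⟨t, -, rfl⟩ := List.mem_map.mp hg
    exact affReflection_mem hP b _ _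

/-- The half-space of the wall `t` of the fundamental simplex, pulled back to the group along the
orbit of `x`. -/
def halfSpace (b : P.Base) (ξ : ι) (x : EuclideanSpace ℝ (Fin n))
    (t : {p : ι × ℤ // IsSimpleAffine b ξ p.1 p.2}) :
    Set (EuclideanSpace ℝ (Fin n) ≃ᵃ[ℝ] EuclideanSpace ℝ (Fin n)) :=
  {g | 0 < ⟪g x, P.root t.1.1⟫_ℝ + t.1.2}

theorem one_mem_halfSpace {b : P.Base} {ξ : ι} {x : EuclideanSpace ℝ (Fin n)}
    (hx : x ∈ openSimplex b ξ) (t) : 1 ∈ halfSpace b ξ x t :=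
  mem_openSimplex_iff.mp hx _ _ t.2

theorem simpleAffineReflection_mul_notMem_halfSpace (hP : IsEuclidean P) {b : P.Base} {ξ : ι}
    {x : EuclideanSpace ℝ (Fin n)} (t) (g) (hg : g ∈ halfSpace b ξ x t) :
    simpleAffineReflection b ξ t * g ∉ halfSpace b ξ x t := by
  intro h
  have h1 : 0 < ⟪affReflection P t.1.1 t.1.2 (g x), P.root t.1.1⟫_ℝ + t.1.2 := h
  have h2 : 0 < ⟪g x, P.root t.1.1⟫_ℝ + t.1.2 := hg
  rw [inner_affReflection hP] at h1
  linarith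

/-- The affine root of `t`, pulled back by `g`, separates `x` from its mirror image in the wall `u`,
hence is the root of `u`; conjugating its reflection by `g` gives the identity. -/
theorem simpleAffineReflection_mul_eq [Finite ι] [P.IsRootSystem] [P.IsCrystallographic]
    [P.IsReduced] (hP : IsEuclidean P) {b : P.Base} {ξ : ι} (hξ : IsHighestRoot b ξ)
    {x : EuclideanSpace ℝ (Fin n)} (hx : x ∈ openSimplex b ξ) (t u) {g}
    (hg : g ∈ affineWeylGroup hP b) (hpos : g ∈ halfSpace b ξ x t)
    (hneg : g * simpleAffineReflection b ξ u ∉ halfSpace b ξ x t) :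
    simpleAffineReflection b ξ t * g = g * simpleAffineReflection b ξ u := by
  obtain ⟨l, m, hlm, hcomm⟩ := exists_affineRoot_comp hP hg t.1.1 t.1.2
  have h1 : 0 < ⟪g x, P.root t.1.1⟫_ℝ + t.1.2 := hpos
  have h2 : ¬ 0 < ⟪g (affReflection P u.1.1 u.1.2 x), P.root t.1.1⟫_ℝ + t.1.2 := hneg
  rw [hlm] at h1 h2
  obtain ⟨rfl, rfl⟩ := affineRoot_eq_of_separates hP hξ hx u.2 h1 (not_lt.mp h2)
  exact hcomm

/-- The affine Weyl group acts freely on the interiors of the alcoves. -/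
theorem eq_one_of_mem_openSimplex [Finite ι] [P.IsRootSystem] [P.IsCrystallographic]
    [P.IsReduced] [P.IsIrreducible] (hP : IsEuclidean P) {b : P.Base} {ξ : ι}
    (hξ : IsHighestRoot b ξ) {x : EuclideanSpace ℝ (Fin n)} (hx : x ∈ openSimplex b ξ) {g}
    (hg : g ∈ affineWeylGroup hP b) (hgx : g x ∈ openSimplex b ξ) : g = 1 := by
  have hs := simpleAffineReflection_mul_self hP (b := b) (ξ := ξ)
  obtain ⟨l, rfl⟩ := exists_word_of_mem_closure hs (affineWeylGroup_le_closure hP hξ hg)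
  exact word_eq_one_of_mem_halfSpaces hs (one_mem_halfSpace hx)
    (simpleAffineReflection_mul_notMem_halfSpace hP)
    (fun t u l => simpleAffineReflection_mul_eq hP hξ hx t u (simpleAffineWord_mem hP b ξ l)) l
    fun t => mem_openSimplex_iff.mp hgx _ _ t.2

/-- Two points of the fundamental simplex in the same orbit of the affine Weyl group are equal. -/
theorem apply_eq_of_mem_fundamentalSimplex [Finite ι] [P.IsRootSystem] [P.IsCrystallographic]
    [P.IsReduced] [P.IsIrreducible] (hP : IsEuclidean P) {b : P.Base} {ξ : ι}
    (hξ : IsHighestRoot b ξ) {a : EuclideanSpace ℝ (Fin n)} (ha : a ∈ fundamentalSimplex b ξ) {g}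
    (hg : g ∈ affineWeylGroup hP b) (hga : g a ∈ fundamentalSimplex b ξ) : g a = a := by
  have hs := simpleAffineReflection_mul_self hP (b := b) (ξ := ξ)
  obtain ⟨x, hx⟩ := openSimplex_nonempty hξ
  obtain ⟨l, rfl⟩ := exists_word_of_mem_closure hs (affineWeylGroup_le_closure hP hξ hg)
  clear hg
  induction h : l.length using Nat.strong_induction_on generalizing l with
  | _ N ih =>
    by_cases hl : ∀ t, (l.map (simpleAffineReflection b ξ)).prod ∈ halfSpace b ξ x t
    · rw [word_eq_one_of_mem_halfSpaces hs (one_mem_halfSpace hx)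
        (simpleAffineReflection_mul_notMem_halfSpace hP)
        (fun t u l => simpleAffineReflection_mul_eq hP hξ hx t u (simpleAffineWord_mem hP b ξ l))
        l hl]
      rfl
    -- If `g x` is not on the positive side of the wall `t`, all of `gF` is weakly on the other
    -- side. As `g a` lies in `F`, it is on the wall and fixed by its reflection, so a shorter word
    -- sends `a` to the same point.
    · push Not at hl
      obtain ⟨t, ht⟩ := hl
      obtain ⟨l', hlen, hl'⟩ := exists_shorter_word hs (one_mem_halfSpace hx)
        (fun t u l => simpleAffineReflection_mul_eq hP hξ hx t u (simpleAffineWord_mem hP b ξ l))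
        t l ht
      set g := (l.map (simpleAffineReflection b ξ)).prod
      have h1 : ¬ 0 < ⟪g x, P.root t.1.1⟫_ℝ + t.1.2 := ht
      obtain ⟨i, k, hik, -⟩ :=
        exists_affineRoot_comp hP (simpleAffineWord_mem hP b ξ l) t.1.1 t.1.2
      rw [hik, not_lt] at h1
      have h2 := affineRoot_nonpos hξ hx ha h1
      rw [← hik] at h2
      have h3 := mem_fundamentalSimplex_iff.mp hga _ _ t.2
      have h4 : (l'.map (simpleAffineReflection b ξ)).prod a = g a := by
        rw [hl']
        exact affReflection_apply_of_eq_zero hP (le_antisymm h2 h3)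
      rw [← h4]
      exact ih l'.length (h ▸ hlen) l' (by rwa [h4]) rfl

theorem finite_dualRootLattice_inter_closedBall [P.IsRootSystem] (b : P.Base)
    (x : EuclideanSpace ℝ (Fin n)) (r : ℝ) :
    ((dualRootLattice b : Set (EuclideanSpace ℝ (Fin n))) ∩ Metric.closedBall x r).Finite := by
  have h : (dualRootLattice b : Set (EuclideanSpace ℝ (Fin n))) =
      Submodule.span ℤ (Set.range b.toCoweightBasis) := by
    have : Set.range b.toCoweightBasis = P.coroot '' b.support := by
      ext v; simp
    rw [this, ← Submodule.coe_toAddSubgroup, Submodule.span_int_eq_addSubgroupClosure]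
    rfl
  rw [h, Set.inter_comm]
  exact ZSpan.setFinite_inter b.toCoweightBasis Metric.isBounded_closedBall

/-- Every point has an orbit representative closest to a given point. -/
theorem exists_closest [Finite ι] [P.IsRootSystem] [P.IsCrystallographic] (hP : IsEuclidean P)
    (b : P.Base) (a x : EuclideanSpace ℝ (Fin n)) :
    ∃ g ∈ affineWeylGroup hP b, ∀ h ∈ affineWeylGroup hP b, ‖g a - x‖ ≤ ‖h a - x‖ := by
  -- Only orbit points no farther from `x` than `a` compete. There are finitely many: for each of
  -- the finitely many `w`, the translation is a lattice vector in a fixed ball.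
  let S : Set (EuclideanSpace ℝ (Fin n)) :=
    {y | (∃ g ∈ affineWeylGroup hP b, g a = y) ∧ ‖y - x‖ ≤ ‖a - x‖}
  have hS : S.Finite := by
    refine ((finite_weylGroup b).biUnion fun w _ =>
      (finite_dualRootLattice_inter_closedBall b (x - w a) ‖a - x‖).image
        (fun q => w a + q)).subset ?_
    rintro _ ⟨⟨g, ⟨w, hw, q, hq, hg⟩, rfl⟩, hy⟩
    refine Set.mem_biUnion hw ⟨q, ⟨hq, ?_⟩, (hg a).symm⟩
    rw [Metric.mem_closedBall, dist_eq_norm]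
    have h1 : q - (x - w a) = g a - x := by rw [hg]; abel
    rwa [h1]
  obtain ⟨y, ⟨⟨g, hg, rfl⟩, hy⟩, hmin⟩ :=
    hS.exists_minimalFor (fun y => ‖y - x‖) S ⟨a, ⟨1, one_mem _, rfl⟩, le_rfl⟩
  refine ⟨g, hg, fun h hh => ?_⟩
  by_contra! hlt
  exact absurd (hmin ⟨⟨h, hh, rfl⟩, hlt.le.trans hy⟩ hlt.le) (not_le.mpr hlt)

/-- Every orbit of the affine Weyl group meets the fundamental simplex. -/
theorem exists_apply_mem_fundamentalSimplex [Finite ι] [P.IsRootSystem] [P.IsCrystallographic]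
    [P.IsReduced] (hP : IsEuclidean P) {b : P.Base} {ξ : ι} (hξ : IsHighestRoot b ξ)
    (a : EuclideanSpace ℝ (Fin n)) :
    ∃ g ∈ affineWeylGroup hP b, g a ∈ fundamentalSimplex b ξ := by
  obtain ⟨x, hx⟩ := openSimplex_nonempty hξ
  obtain ⟨g, hg, hmin⟩ := exists_closest hP b a x
  refine ⟨g, hg, mem_fundamentalSimplex_iff.mpr fun i k hik => ?_⟩
  by_contra! hneg
  have h1 := norm_affReflection_sub_lt hP hneg (mem_openSimplex_iff.mp hx i k hik)
  have h2 := hmin _ (mul_mem (affReflection_mem hP b i k) hg)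
  exact absurd h1 (not_lt.mpr h2)

/-! ### Parity -/

theorem linear_eq_of_apply_eq {g : EuclideanSpace ℝ (Fin n) ≃ᵃ[ℝ] EuclideanSpace ℝ (Fin n)}
    {w : EuclideanSpace ℝ (Fin n) ≃ₗ[ℝ] EuclideanSpace ℝ (Fin n)} {q : EuclideanSpace ℝ (Fin n)}
    (h : ∀ a, g a = w a + q) : g.linear = w := by
  ext1 v
  have h1 := g.map_vadd 0 v
  simp only [vadd_eq_add, add_zero, h, map_zero, zero_add] at h1
  exact (add_right_cancel h1).symm

/-- The determinant of the linear part of an affine map. -/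
def sign : (EuclideanSpace ℝ (Fin n) ≃ᵃ[ℝ] EuclideanSpace ℝ (Fin n)) →* ℝˣ :=
  LinearEquiv.det.comp AffineEquiv.linearHom

theorem mem_evenAffineWeylGroup_iff [P.IsCrystallographic] {hP : IsEuclidean P} {b : P.Base}
    {g : EuclideanSpace ℝ (Fin n) ≃ᵃ[ℝ] EuclideanSpace ℝ (Fin n)} :
    g ∈ evenAffineWeylGroup hP b ↔ g ∈ affineWeylGroup hP b ∧ sign g = 1 := by
  constructor
  · rintro ⟨w, hw, q, hq, hg⟩
    refine ⟨⟨w, hw.1, q, hq, hg⟩, ?_⟩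
    change LinearEquiv.det g.linear = 1
    rw [linear_eq_of_apply_eq hg]
    exact hw.2
  · rintro ⟨⟨w, hw, q, hq, hg⟩, h⟩
    change LinearEquiv.det g.linear = 1 at h
    rw [linear_eq_of_apply_eq hg] at h
    exact ⟨w, ⟨hw, h⟩, q, hq, hg⟩

theorem sign_eq_or [P.IsCrystallographic] {hP : IsEuclidean P} {b : P.Base}
    {g : EuclideanSpace ℝ (Fin n) ≃ᵃ[ℝ] EuclideanSpace ℝ (Fin n)}
    (hg : g ∈ affineWeylGroup hP b) : sign g = 1 ∨ sign g = -1 := by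
  obtain ⟨w, hw, q, hq, hg⟩ := hg
  change LinearEquiv.det g.linear = 1 ∨ LinearEquiv.det g.linear = -1
  rw [linear_eq_of_apply_eq hg]
  exact weylGroup_det hw

theorem sign_affReflection (i : ι) (k : ℤ) : sign (affReflection P i k) = -1 := by
  change LinearEquiv.det (affReflection P i k).linear = -1
  rw [affReflection, linear_eq_of_apply_eq (affineMotion_apply _ _), det_reflection]

theorem affReflection_zero_apply (i : ι) (x) : affReflection P i 0 x = P.reflection i x := by
  simp [affReflection, affineMotion_apply]

/-! ### Isotropy groups -/

/-- A point on the boundary of the fundamental simplex is fixed by a reflection. -/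
theorem exists_affReflection_apply_eq (hP : IsEuclidean P) {b : P.Base} {ξ : ι}
    {a : EuclideanSpace ℝ (Fin n)} (ha : a ∈ fundamentalSimplex b ξ) (ha' : a ∉ openSimplex b ξ) :
    ∃ i k, affReflection P i k a = a := by
  rw [mem_openSimplex_iff] at ha'
  push Not at ha'
  obtain ⟨i, k, hik, h⟩ := ha'
  exact ⟨i, k, affReflection_apply_of_eq_zero hP
    (le_antisymm h (mem_fundamentalSimplex_iff.mp ha i k hik))⟩

/-- The linear part `w` of an element fixing `a` determines its translation part, `a - w a`. -/
theorem finite_stab_affineWeylGroup [Finite ι] [P.IsRootSystem] [P.IsCrystallographic]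
    (hP : IsEuclidean P) (b : P.Base) (a : EuclideanSpace ℝ (Fin n)) :
    Finite (stab (affineWeylGroup hP b) a) := by
  refine Set.Finite.subset ((finite_weylGroup b).image fun w => affineMotion w (a - w a)) ?_
  rintro g ⟨⟨w, hw, q, hq, hg⟩, hga⟩
  refine ⟨w, hw, ?_⟩
  ext1 x
  have h1 : a - w a = q := by rw [sub_eq_iff_eq_add', ← hg, hga]
  rw [affineMotion_apply, hg, h1]

/-- The stabilizer contains a reflection, and multiplying by it exchanges even and odd elements, so
the even part has index two. -/
theorem card_stab_affineWeylGroup [Finite ι] [P.IsCrystallographic] [P.IsReduced]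
    (hP : IsEuclidean P) {b : P.Base} {a : EuclideanSpace ℝ (Fin n)} {i : ι} {k : ℤ}
    (h : affReflection P i k a = a) :
    Nat.card (stab (affineWeylGroup hP b) a) =
      2 * Nat.card (stab (evenAffineWeylGroup hP b) a) := by
  have hle : stab (evenAffineWeylGroup hP b) a ≤ stab (affineWeylGroup hP b) a :=
    fun g hg => ⟨(mem_evenAffineWeylGroup_iff.mp hg.1).1, hg.2⟩
  have hidx : (stab (evenAffineWeylGroup hP b) a).relIndex (stab (affineWeylGroup hP b) a) = 2 := by
    have hr : affReflection P i k ∈ stab (affineWeylGroup hP b) a :=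
      ⟨affReflection_mem hP b i k, h⟩
    refine Subgroup.relIndex_eq_two_iff_exists_notMem_and.mpr
      ⟨_, hr, fun hmem => ?_, fun g hg => ?_⟩
    · have := (mem_evenAffineWeylGroup_iff.mp hmem.1).2
      rw [sign_affReflection] at this
      exact absurd (congrArg Units.val this) (by norm_num)
    · rcases sign_eq_or hg.1 with h1 | h1
      · exact Or.inr ⟨mem_evenAffineWeylGroup_iff.mpr ⟨hg.1, h1⟩, hg.2⟩
      · have h2 := mul_mem hg hr
        refine Or.inl ⟨mem_evenAffineWeylGroup_iff.mpr ⟨h2.1, ?_⟩, h2.2⟩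
        rw [map_mul, h1, sign_affReflection]
        simp
  have hcard := Subgroup.relIndex_mul_relIndex ⊥ _ _ bot_le hle
  rw [Subgroup.relIndex_bot_left, Subgroup.relIndex_bot_left, hidx] at hcard
  omega

/-- Conjugating by `h` moves the question to `x`, where the whole affine Weyl group acts freely.
Taking `h = 1` and `h = r_j` covers both copies of the interior. -/
theorem stab_evenAffineWeylGroup_eq_bot [Finite ι] [P.IsRootSystem] [P.IsCrystallographic]
    [P.IsReduced] [P.IsIrreducible] (hP : IsEuclidean P) {b : P.Base} {ξ : ι}
    (hξ : IsHighestRoot b ξ) {x : EuclideanSpace ℝ (Fin n)} (hx : x ∈ openSimplex b ξ)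
    {h} (hh : h ∈ affineWeylGroup hP b) : stab (evenAffineWeylGroup hP b) (h x) = ⊥ := by
  refine (Subgroup.eq_bot_iff_forall _).mpr fun g hg => ?_
  have h1 := (mem_evenAffineWeylGroup_iff.mp hg.1).1
  have h2 : (h⁻¹ * g * h) x = x := by
    change h⁻¹ (g (h x)) = x
    rw [hg.2]
    exact h.symm_apply_apply x
  have h3 := eq_one_of_mem_openSimplex hP hξ hx (mul_mem (mul_mem (inv_mem hh) h1) hh)
    (by rwa [h2])
  rwa [mul_assoc, inv_mul_eq_one, eq_comm, mul_eq_right] at h3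

/-! ### The region `F^e` as a fundamental domain of the even group -/

/-- Two points of `F^e` in the same orbit of the even affine Weyl group are equal. -/
theorem eq_of_mem_evenFundamentalRegion [Finite ι] [P.IsRootSystem] [P.IsCrystallographic]
    [P.IsReduced] [P.IsIrreducible] (hP : IsEuclidean P) {b : P.Base} {ξ : ι}
    (hξ : IsHighestRoot b ξ) {j : ι} {a a' : EuclideanSpace ℝ (Fin n)}
    (ha : a ∈ evenFundamentalRegion b ξ j) (ha' : a' ∈ evenFundamentalRegion b ξ j) {g}
    (hg : g ∈ evenAffineWeylGroup hP b) (h : a' = g a) : a = a' := by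
  obtain ⟨hgW, hgs⟩ := mem_evenAffineWeylGroup_iff.mp hg
  have hr := affReflection_mem hP b j 0
  have hrr := affReflection_mul_self hP j 0
  have hrs : sign (affReflection P j 0) = -1 := sign_affReflection j 0
  have hinv : ∀ x, affReflection P j 0 (affReflection P j 0 x) = x := fun x =>
    congrArg (fun f : EuclideanSpace ℝ (Fin n) ≃ᵃ[ℝ] EuclideanSpace ℝ (Fin n) => f x) hrr
  -- Such an element would fix an interior point of `F`, hence be the identity, which is even.
  have odd : ∀ f, f ∈ affineWeylGroup hP b → sign f = -1 → ∀ x ∈ fundamentalSimplex b ξ,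
      f x ∉ openSimplex b ξ := by
    intro f hf hs x hx hfx
    have h1 := apply_eq_of_mem_fundamentalSimplex hP hξ hx hf (openSimplex_subset b ξ hfx)
    have h2 := eq_one_of_mem_openSimplex hP hξ (h1 ▸ hfx) hf hfx
    rw [h2, map_one] at hs
    exact absurd (congrArg Units.val hs) (by norm_num)
  rw [evenFundamentalRegion, interior_fundamentalSimplex] at ha ha'
  simp only [Set.mem_union, Set.mem_image, ← affReflection_zero_apply] at ha ha'
  -- When the points lie in different pieces, composing with `r_j` gives an odd element from `F`
  -- into `int(F)`; when both lie in `r_j int(F)`, conjugation by `r_j` brings them back to `F`.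
  rcases ha with ha | ⟨x, hx, rfl⟩ <;> rcases ha' with ha' | ⟨y, hy, rfl⟩
  · rw [h] at ha' ⊢
    exact (apply_eq_of_mem_fundamentalSimplex hP hξ ha hgW ha').symm
  · refine absurd ?_ (odd _ (mul_mem hr hgW) (by simp [hrs, hgs]) a ha)
    change affReflection P j 0 (g a) ∈ _
    rwa [← h, hinv]
  · refine absurd ?_ (odd _ (mul_mem hr (inv_mem hgW)) (by simp [hrs, hgs]) a' ha')
    change affReflection P j 0 (g.symm a') ∈ _
    rwa [h, AffineEquiv.symm_apply_apply, hinv]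
  · have h1 : (affReflection P j 0 * g * affReflection P j 0) x = y := by
      change affReflection P j 0 (g (affReflection P j 0 x)) = y
      rw [← h, hinv]
    have h2 := apply_eq_of_mem_fundamentalSimplex hP hξ (openSimplex_subset b ξ hx)
      (mul_mem (mul_mem hr hgW) hr) (by rw [h1]; exact openSimplex_subset b ξ hy)
    rw [← h2, h1]

/-- Every orbit of the even affine Weyl group meets `F^e`. -/
theorem exists_evenFundamentalRegion_apply_eq [Finite ι] [P.IsRootSystem] [P.IsCrystallographic]
    [P.IsReduced] (hP : IsEuclidean P) {b : P.Base} {ξ : ι} (hξ : IsHighestRoot b ξ) (j : ι)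
    (a : EuclideanSpace ℝ (Fin n)) :
    ∃ a' ∈ evenFundamentalRegion b ξ j, ∃ g ∈ evenAffineWeylGroup hP b, a = g a' := by
  obtain ⟨f, hf, hfa⟩ := exists_apply_mem_fundamentalSimplex hP hξ a
  have hfinv : f⁻¹ (f a) = a := f.symm_apply_apply a
  rcases sign_eq_or hf with hs | hs
  · exact ⟨f a, Or.inl hfa, f⁻¹, mem_evenAffineWeylGroup_iff.mpr ⟨inv_mem hf, by simp [hs]⟩,
      hfinv.symm⟩
  -- Here `f` is odd. Parity is repaired by `r_j` in the interior, and on the boundary by a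
  -- reflection fixing `f a`.
  by_cases hint : f a ∈ openSimplex b ξ
  · refine ⟨affReflection P j 0 (f a), Or.inr ⟨f a, ?_, ?_⟩, f⁻¹ * affReflection P j 0,
      mem_evenAffineWeylGroup_iff.mpr ⟨mul_mem (inv_mem hf) (affReflection_mem hP b j 0),
        by simp [hs, sign_affReflection]⟩, ?_⟩
    · rwa [interior_fundamentalSimplex]
    · rw [affReflection_zero_apply]
    · have hinv : affReflection P j 0 (affReflection P j 0 (f a)) = f a :=
        congrArg (fun h : EuclideanSpace ℝ (Fin n) ≃ᵃ[ℝ] EuclideanSpace ℝ (Fin n) => h (f a))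
          (affReflection_mul_self hP j 0)
      change a = f⁻¹ (affReflection P j 0 (affReflection P j 0 (f a)))
      rw [hinv, hfinv]
  · obtain ⟨i, k, hik⟩ := exists_affReflection_apply_eq hP hfa hint
    refine ⟨f a, Or.inl hfa, f⁻¹ * affReflection P i k,
      mem_evenAffineWeylGroup_iff.mpr ⟨mul_mem (inv_mem hf) (affReflection_mem hP b i k),
        by simp [hs, sign_affReflection]⟩, ?_⟩
    change a = f⁻¹ (affReflection P i k (f a))
    rw [hik, hfinv]

end EvenAffineWeyl

end

theorem mainTheorem1 {n : ℕ} {ι : Type*} [Finite ι]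
    (P : RootPairing ι ℝ (EuclideanSpace ℝ (Fin n)) (EuclideanSpace ℝ (Fin n)))
    [P.IsRootSystem] [P.IsCrystallographic] [P.IsReduced] [P.IsIrreducible]
    (hP : EvenAffineWeyl.IsEuclidean P) (b : P.Base)
    (ξ : ι) (hξ : EvenAffineWeyl.IsHighestRoot b ξ) (j : ι) (hj : j ∈ b.support) :
    -- every point is equivalent to a point of `F^e`
    (∀ a, ∃ a' ∈ EvenAffineWeyl.evenFundamentalRegion b ξ j,
      ∃ w ∈ EvenAffineWeyl.evenWeylGroup b, ∃ q ∈ EvenAffineWeyl.dualRootLattice b,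
        a = w a' + q) ∧
    -- equivalent points of `F^e` are equal
    (∀ a ∈ EvenAffineWeyl.evenFundamentalRegion b ξ j,
      ∀ a' ∈ EvenAffineWeyl.evenFundamentalRegion b ξ j,
        ∀ g ∈ EvenAffineWeyl.evenAffineWeylGroup hP b, a' = g a → a = a') ∧
    (∀ a ∈ EvenAffineWeyl.evenFundamentalRegion b ξ j,
      ∀ a' ∈ EvenAffineWeyl.evenFundamentalRegion b ξ j,
        ∀ w ∈ EvenAffineWeyl.evenWeylGroup b, ∀ q ∈ EvenAffineWeyl.dualRootLattice b,
          a' = w a + q → a' = a ∧ a = w a + q) ∧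
    -- trivial stabilizers on `int(F)` and on `r_j int(F)`
    (∀ a ∈ interior (EvenAffineWeyl.fundamentalSimplex b ξ),
      EvenAffineWeyl.stab (EvenAffineWeyl.evenAffineWeylGroup hP b) a = ⊥) ∧
    (∀ a ∈ P.reflection j '' interior (EvenAffineWeyl.fundamentalSimplex b ξ),
      EvenAffineWeyl.stab (EvenAffineWeyl.evenAffineWeylGroup hP b) a = ⊥) ∧
    -- stabilizers on the boundary of `F`
    (∀ a ∈ EvenAffineWeyl.fundamentalSimplex b ξ \
        interior (EvenAffineWeyl.fundamentalSimplex b ξ),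
      Finite (EvenAffineWeyl.stab (EvenAffineWeyl.affineWeylGroup hP b) a) ∧
      Nat.card (EvenAffineWeyl.stab (EvenAffineWeyl.affineWeylGroup hP b) a) =
        2 * Nat.card (EvenAffineWeyl.stab (EvenAffineWeyl.evenAffineWeylGroup hP b) a)) := by
  refine ⟨fun a => ?_, fun a ha a' ha' g hg h => ?_, fun a ha a' ha' w hw q hq h => ?_,
    fun a ha => ?_, fun a ha => ?_, fun a ha => ?_⟩
  · obtain ⟨a', ha', g, ⟨w, hw, q, hq, hg⟩, h⟩ :=
      EvenAffineWeyl.exists_evenFundamentalRegion_apply_eq hP hξ j a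
    exact ⟨a', ha', w, hw, q, hq, h.trans (hg a')⟩
  · exact EvenAffineWeyl.eq_of_mem_evenFundamentalRegion hP hξ ha ha' hg h
  · have h1 := EvenAffineWeyl.affineMotion_apply w q
    have h2 : a = a' := EvenAffineWeyl.eq_of_mem_evenFundamentalRegion hP hξ ha ha'
      ⟨w, hw, q, hq, h1⟩ (h.trans (h1 a).symm)
    exact ⟨h2.symm, h2.trans h⟩
  · rw [EvenAffineWeyl.interior_fundamentalSimplex] at ha
    exact EvenAffineWeyl.stab_evenAffineWeylGroup_eq_bot hP hξ ha (one_mem _)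
  · rw [EvenAffineWeyl.interior_fundamentalSimplex] at ha
    obtain ⟨x, hx, rfl⟩ := ha
    rw [← EvenAffineWeyl.affReflection_zero_apply]
    exact EvenAffineWeyl.stab_evenAffineWeylGroup_eq_bot hP hξ hx
      (EvenAffineWeyl.affReflection_mem hP b j 0)
  · rw [EvenAffineWeyl.interior_fundamentalSimplex] at ha
    obtain ⟨i, k, hik⟩ := EvenAffineWeyl.exists_affReflection_apply_eq hP ha.1 ha.2
    exact ⟨EvenAffineWeyl.finite_stab_affineWeylGroup hP b a,
      EvenAffineWeyl.card_stab_affineWeylGroup hP hik⟩
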